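/- Let $k$ be an algebraically closed field of characteristic $0$ and let $A$ be a finite-dimensional Hopf algebra over $k$ (not necessarily semisimple) with comultiplication $\Delta(a)=\sum a_1\otimes a_2$, counit $\varepsilon$ and antipode $S$. Let $m$ be a positive integer and let $\tau$ be a Hopf algebra automorphism of $A$ whose order divides $m$. For a Hopf algebra automorphism $\sigma$ of $A$ and $x\in A$ put $$x^{[m,\sigma]}=\sum x_1(\sigma\cdot x_2)(\sigma^2\cdot x_3)\cdots(\sigma^{m-1}\cdot x_m),$$ let $P_{m-1,\tau}:A\to A$ be the linear map $$P_{m-1,\tau}(a)=\sum(\tau^{m-1}\cdot a_1)(\tau^{m-2}\cdot a_2)\cdots(\tau\cdot a_{m-1})$$ (with $P_{0,\tau}(a)=\varepsilon(a)1$ when $m=1$), and define the $m$-th twisted Frobenius–Schur indicator of $A$ by $\nu_{m,\tau}(A)=\operatorname{Tr}(S\circ P_{m-1,\tau})$. Here $\Lambda\in A$ is a left (right) integral of $A$ if $a\Lambda=\varepsilon(a)\Lambda$ (resp. $\Lambda a=\varepsilon(a)\Lambda$) for all $a\in A$, and $\lambda\in A^*$ is a left (right) integral of $A^*$ if $f\lambda=f(1)\lambda$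 (resp. $\lambda f=f(1)\lambda$) for all $f\in A^*$, where $A^*$ has the convolution product $(fg)(a)=\sum f(a_1)g(a_2)$. 1. If $\Lambda_r$ is a right integral of $A$ and $\lambda_r$ is a right integral of $A^*$ with $\lambda_r(\Lambda_r)=1$, then $$\nu_{m,\tau}(A)=\lambda_r\big(\Lambda_r^{[m,\tau]}\big).$$ 2. If $\Lambda_l$ is a left integral of $A$ and $\lambda_l$ is a left integral of $A^*$ with $\lambda_l(\Lambda_l)=1$, then $$\nu_{m,\tau}(A)=\lambda_l\big(\tau^{-1}\cdot\Lambda_l^{[m,\tau^{-1}]}\big).$$ -/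

import Mathlib

namespace TwistedIndicator

open Coalgebra HopfAlgebra

universe u v

variable {k : Type u} [Field k] {A : Type v} [Ring A]

section Bialgebra

variable [Bialgebra k A]

/-- For linear maps `f₁, …, fₙ : A → A`, the map `x ↦ ∑ f₁(x₁) f₂(x₂) ⋯ fₙ(xₙ)` (Sweedler
notation): apply the iterated comultiplication, then the `fᵢ` factorwise, then multiply.
This is the product `f₁ * f₂ * ⋯ * fₙ` in the convolution algebra of linear maps `A → A`;
for `n = 0` it is the convolution unit `x ↦ ε(x) 1`. -/
noncomputable def sweedlerProd (fs : List (A →ₗ[k] A)) : A →ₗ[k] A :=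
  (fs.map WithConv.toConv).prod.ofConv

/-- The linear map `x ↦ τ^i · x`, where the power is taken with respect to composition. -/
noncomputable def powMap (τ : A ≃ₐc[k] A) (i : ℕ) : A →ₗ[k] A :=
  (((τ : A ≃ₐ[k] A) ^ i : A ≃ₐ[k] A) : A →ₐ[k] A).toLinearMap

/-- The `n`-th `τ`-twisted Hopf power
`x^{[n,τ]} = ∑ x₁ (τ · x₂) (τ² · x₃) ⋯ (τ^{n-1} · xₙ)`. -/
noncomputable def twistedHopfPower (n : ℕ) (τ : A ≃ₐc[k] A) : A →ₗ[k] A :=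
  sweedlerProd ((List.range n).map fun i => powMap τ i)

/-- The map `P_{n,τ}(a) = ∑ (τ^n · a₁) (τ^{n-1} · a₂) ⋯ (τ · aₙ)`. -/
noncomputable def variantPower (n : ℕ) (τ : A ≃ₐc[k] A) : A →ₗ[k] A :=
  sweedlerProd ((List.range n).map fun i => powMap τ (n - i))

variable (k) in
/-- `Λ ∈ A` is a left integral of `A`: `a Λ = ε(a) Λ` for all `a`. -/
def IsLeftIntegral (Λ : A) : Prop :=
  ∀ a : A, a * Λ = counit (R := k) a • Λ

variable (k) in
/-- `Λ ∈ A` is a right integral of `A`: `Λ a = ε(a) Λ` for all `a`. -/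
def IsRightIntegral (Λ : A) : Prop :=
  ∀ a : A, Λ * a = counit (R := k) a • Λ

/-- `l ∈ A*` is a left integral of `A*`: `f * l = f(1) l` for all `f ∈ A*`, where the product of
`A*` is convolution `(f * g)(a) = ∑ f(a₁) g(a₂)` and its counit is `f ↦ f(1)`. -/
def IsLeftDualIntegral (l : A →ₗ[k] k) : Prop :=
  ∀ f : A →ₗ[k] k, WithConv.toConv f * WithConv.toConv l = f 1 • WithConv.toConv l

/-- `l ∈ A*` is a right integral of `A*`: `l * f = f(1) l` for all `f ∈ A*`. -/
def IsRightDualIntegral (l : A →ₗ[k] k) : Prop :=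
  ∀ f : A →ₗ[k] k, WithConv.toConv l * WithConv.toConv f = f 1 • WithConv.toConv l

end Bialgebra

/-- The `m`-th twisted Frobenius–Schur indicator `ν_{m,τ}(A) = Tr (S ∘ P_{m-1,τ})`, for `m ≥ 1`. -/
noncomputable def twistedIndicator [HopfAlgebra k A] (m : ℕ) (τ : A ≃ₐc[k] A) : k :=
  LinearMap.trace k A (antipode k ∘ₗ variantPower (m - 1) τ)

end TwistedIndicator

namespace TwistedIndicator

open Coalgebra HopfAlgebra TensorProduct WithConv LinearMap

/-! ### Convolution algebra and the antipode -/

section Convolution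

variable {k A B : Type*} [Field k] [Ring A] [HopfAlgebra k A] [Ring B] [Algebra k B]

/-! Everything rests on Radford's formula: normalized integrals give `S(a) = ∑ λ(Λ₁ a) Λ₂` (right)
or `S(a) = ∑ λ(a Λ₂) Λ₁` (left), a sum of rank-one maps, so `Tr(S ∘ Q)` is `λ` of `id * Q` (resp. `Q
* id`) at `Λ`. Left case: take `Q = P_{m-1,τ}`; since `τ^m = 1`, the factors `τ^{m-1}, …, τ, id` of
`Q * id` are `τ⁻¹, τ⁻², …, τ^{-m}`. Right case: `S` commutes with `τ` and reverses convolution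
products, so moving it past `P_{m-1,τ}` and using cyclicity of the trace leaves `Q = τ * τ² * ⋯ *
τ^{m-1}`. -/

lemma algHom_comp_convOne (i : A →ₐ[k] B) :
    i.toLinearMap ∘ₗ (1 : WithConv (A →ₗ[k] A)).ofConv = (1 : WithConv (A →ₗ[k] B)).ofConv := by
  ext a
  exact i.commutes _

lemma algHom_antipode_convMul (i : A →ₐ[k] B) :
    toConv (i.toLinearMap ∘ₗ antipode k) * toConv i.toLinearMap = 1 := by
  have h := algHom_comp_convMul_distrib i (toConv (antipode k)) (toConv LinearMap.id)
  rw [antipode_mul_id, algHom_comp_convOne] at h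
  exact (WithConv.ofConv_injective h).symm

lemma algHom_convMul_antipode (i : A →ₐ[k] B) :
    toConv i.toLinearMap * toConv (i.toLinearMap ∘ₗ antipode k) = 1 := by
  have h := algHom_comp_convMul_distrib i (toConv LinearMap.id) (toConv (antipode k))
  rw [id_mul_antipode, algHom_comp_convOne] at h
  exact (WithConv.ofConv_injective h).symm

variable (k A) in
/-- The embedding `a ↦ a ⊗ 1`. -/
noncomputable abbrev inl : A →ₐ[k] A ⊗[k] A := Algebra.TensorProduct.includeLeft

variable (k A) in
/-- The embedding `a ↦ 1 ⊗ a`. -/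
noncomputable abbrev inr : A →ₐ[k] A ⊗[k] A := Algebra.TensorProduct.includeRight

lemma inl_convMul_inr :
    toConv (inl k A).toLinearMap * toConv (inr k A).toLinearMap = toConv (comul (R := k)) := by
  ext a
  rw [(ℛ k a).convMul_apply]
  simp [(ℛ k a).eq]

lemma comul_convMul_inr_antipode :
    toConv (comul (R := k)) * toConv ((inr k A).toLinearMap ∘ₗ antipode k) =
      toConv (inl k A).toLinearMap := by
  rw [← inl_convMul_inr, mul_assoc, algHom_convMul_antipode, mul_one]

lemma inl_antipode_convMul_comul :
    toConv ((inl k A).toLinearMap ∘ₗ antipode k) * toConv (comul (R := k)) =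
      toConv (inr k A).toLinearMap := by
  rw [← inl_convMul_inr, ← mul_assoc, algHom_antipode_convMul, one_mul]

/-- Both sides are convolution inverses of `Δ` in `Hom(A, A ⊗ A)`; the right-hand one arises from
the factorization `Δ = inl * inr`. -/
lemma comul_antipode (a : A) :
    comul (R := k) (antipode k a) =
      map (antipode k) (antipode k) (TensorProduct.comm k A A (comul a)) := by
  have h1 : toConv ((inr k A).toLinearMap ∘ₗ antipode k) *
      toConv ((inl k A).toLinearMap ∘ₗ antipode k) * toConv (comul (R := k)) = 1 := by
    rw [mul_assoc, inl_antipode_convMul_comul, algHom_antipode_convMul]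
  have h2 := left_inv_eq_right_inv h1 (comul_right_inv (R := k) (C := A))
  have h3 := congr($h2 a)
  rw [(ℛ k a).convMul_apply] at h3
  refine Eq.trans h3.symm ?_
  rw [← (ℛ k a).eq]
  simp

lemma antipode_comp_convMul {f g f' g' : A →ₗ[k] A}
    (hf : antipode k ∘ₗ f = f' ∘ₗ antipode k) (hg : antipode k ∘ₗ g = g' ∘ₗ antipode k) :
    antipode k ∘ₗ (toConv f * toConv g).ofConv =
      (toConv g' * toConv f').ofConv ∘ₗ antipode k := by
  ext a
  have hf' (x : A) : antipode k (f x) = f' (antipode k x) := congr($hf x)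
  have hg' (x : A) : antipode k (g x) = g' (antipode k x) := congr($hg x)
  have h1 : (toConv f * toConv g).ofConv a = _ := (ℛ k a).convMul_apply (toConv f) (toConv g)
  have h2 : (toConv g' * toConv f').ofConv (antipode k a) =
      mul' k A (map g' f' (comul (antipode k a))) := rfl
  rw [LinearMap.comp_apply, LinearMap.comp_apply, h1, h2, comul_antipode, ← (ℛ k a).eq]
  simp [antipode_mul_antidistrib, hf', hg']

lemma antipode_comp_convOne :
    antipode k ∘ₗ (1 : WithConv (A →ₗ[k] A)).ofConv =
      (1 : WithConv (A →ₗ[k] A)).ofConv ∘ₗ antipode k := by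
  ext a
  simp [LinearMap.convOne_def, Algebra.algebraMap_eq_smul_one]

lemma antipode_comp_sweedlerProd (fs : List (A →ₗ[k] A))
    (h : ∀ f ∈ fs, antipode k ∘ₗ f = f ∘ₗ antipode k) :
    antipode k ∘ₗ sweedlerProd fs = sweedlerProd fs.reverse ∘ₗ antipode k := by
  induction fs with
  | nil => exact antipode_comp_convOne
  | cons f fs ih =>
    have := antipode_comp_convMul (h f List.mem_cons_self)
      (ih fun g hg => h g (List.mem_cons_of_mem f hg))
    simpa [sweedlerProd] using this

lemma algHom_comp_sweedlerProd (i : A →ₐ[k] A) (fs : List (A →ₗ[k] A)) :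
    i.toLinearMap ∘ₗ sweedlerProd fs = sweedlerProd (fs.map (i.toLinearMap ∘ₗ ·)) := by
  induction fs with
  | nil => exact algHom_comp_convOne i
  | cons f fs ih =>
    have := algHom_comp_convMul_distrib i (toConv f) (toConv (sweedlerProd fs))
    rw [ih] at this
    simpa [sweedlerProd] using this

/-- Both sides invert `τ` under convolution: `S ∘ τ` because `τ` is a coalgebra map, `τ ∘ S` because
it is an algebra map. -/
lemma antipode_comp_bialgEquiv (τ : A ≃ₐc[k] A) :
    antipode k ∘ₗ ((τ : A ≃ₐ[k] A) : A →ₐ[k] A).toLinearMap =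
      ((τ : A ≃ₐ[k] A) : A →ₐ[k] A).toLinearMap ∘ₗ antipode k := by
  set t : A →ₐ[k] A := ((τ : A ≃ₐ[k] A) : A →ₐ[k] A)
  have h1 : toConv (antipode k ∘ₗ t.toLinearMap) * toConv t.toLinearMap = 1 := by
    have h := convMul_comp_coalgHom_distrib (toConv (antipode k)) (toConv LinearMap.id)
      (τ : A →ₗc[k] A)
    rw [antipode_mul_id] at h
    refine (WithConv.ofConv_injective h).symm.trans ?_
    ext a
    exact congrArg (algebraMap k A) (CoalgHomClass.counit_comp_apply τ a)
  exact congrArg ofConv (left_inv_eq_right_inv h1 (algHom_convMul_antipode t))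

lemma antipode_comp_powMap (τ : A ≃ₐc[k] A) (i : ℕ) :
    antipode k ∘ₗ powMap τ i = powMap τ i ∘ₗ antipode k := by
  induction i with
  | zero => rfl
  | succ i ih =>
    have h : powMap τ (i + 1) =
        powMap τ i ∘ₗ ((τ : A ≃ₐ[k] A) : A →ₐ[k] A).toLinearMap := by
      ext a
      simp [powMap, pow_succ]
    rw [h, ← LinearMap.comp_assoc, ih, LinearMap.comp_assoc, antipode_comp_bialgEquiv,
      LinearMap.comp_assoc]

end Convolution

/-! ### Integrals and Radford's trace formula -/

section Integrals

variable {k A : Type*} [Field k] [Ring A] [HopfAlgebra k A]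

/-- `∑ Λ₁ a ⊗ Λ₂ = ∑ Λ₁ ⊗ Λ₂ S(a)` for a right integral `Λ`. -/
lemma IsRightIntegral.comul_mul_tmul_one {Λ : A} (h : IsRightIntegral k Λ) (a : A) :
    comul (R := k) Λ * (a ⊗ₜ 1) = comul Λ * (1 ⊗ₜ antipode k a) := by
  -- This expansion puts `Δ(a₁)` next to `Δ(Λ)`, which absorbs it as `ε(a₁)`.
  have h2 : ∑ i ∈ (ℛ k a).index, comul (R := k) ((ℛ k a).left i) *
      ((1 : A) ⊗ₜ[k] antipode k ((ℛ k a).right i)) = a ⊗ₜ 1 :=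
    ((ℛ k a).convMul_apply _ _).symm.trans congr($comul_convMul_inr_antipode a)
  have h3 (x : A) : comul (R := k) Λ * comul x = counit (R := k) x • comul Λ := by
    rw [← Bialgebra.comul_mul, h, map_smul]
  simp only [← h2, Finset.mul_sum, ← mul_assoc, h3, smul_mul_assoc]
  simp only [← mul_smul_comm, ← Finset.mul_sum, ← TensorProduct.tmul_smul,
    ← TensorProduct.tmul_sum, ← map_smul, ← map_sum, sum_counit_smul]

/-- `∑ Λ₁ ⊗ a Λ₂ = ∑ S(a) Λ₁ ⊗ Λ₂` for a left integral `Λ`. -/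
lemma IsLeftIntegral.one_tmul_mul_comul {Λ : A} (h : IsLeftIntegral k Λ) (a : A) :
    (1 ⊗ₜ a) * comul (R := k) Λ = (antipode k a ⊗ₜ 1) * comul Λ := by
  have h2 : ∑ i ∈ (ℛ k a).index, (antipode k ((ℛ k a).left i) ⊗ₜ[k] (1 : A)) *
      comul (R := k) ((ℛ k a).right i) = 1 ⊗ₜ a :=
    ((ℛ k a).convMul_apply _ _).symm.trans congr($inl_antipode_convMul_comul a)
  have h3 (x : A) : comul (R := k) x * comul Λ = counit (R := k) x • comul Λ := by
    rw [← Bialgebra.comul_mul, h, map_smul]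
  have h4 : ∑ i ∈ (ℛ k a).index, counit (R := k) ((ℛ k a).right i) • (ℛ k a).left i = a := by
    simpa only [map_sum, TensorProduct.rid_tmul, one_smul] using
      congrArg (TensorProduct.rid k A) (sum_tmul_counit_eq (ℛ k a))
  simp only [← h2, Finset.sum_mul, mul_assoc, h3, mul_smul_comm]
  simp only [← smul_mul_assoc, ← Finset.sum_mul, TensorProduct.smul_tmul',
    ← TensorProduct.sum_tmul, ← map_smul, ← map_sum, h4]

/-- Apply `λ ⊗ id` to `∑ Λ₁ a ⊗ Λ₂ = ∑ Λ₁ ⊗ Λ₂ S(a)` and use `∑ λ(Λ₁) Λ₂ = λ(Λ) 1 = 1`, tested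
against functionals `f`. -/
lemma antipode_eq_sum_of_right {Λ : A} {l : A →ₗ[k] k} (hΛ : IsRightIntegral k Λ)
    (hl : IsRightDualIntegral l) (h1 : l Λ = 1) :
    antipode k =
      ∑ i ∈ (ℛ k Λ).index, (l ∘ₗ mulLeft k ((ℛ k Λ).left i)).smulRight ((ℛ k Λ).right i) := by
  ext a
  rw [← sub_eq_zero, ← Module.forall_dual_apply_eq_zero_iff k]
  intro f
  have h2 := congr(mul' k k (map l f $(hΛ.comul_mul_tmul_one a)))
  have h3 : ∑ i ∈ (ℛ k Λ).index, l ((ℛ k Λ).left i) * f ((ℛ k Λ).right i * antipode k a) =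
      f (1 * antipode k a) * l Λ :=
    ((ℛ k Λ).convMul_apply _ _).symm.trans
      congr($(hl (f ∘ₗ mulRight k (antipode k a))) Λ)
  rw [← (ℛ k Λ).eq] at h2
  simp only [Finset.sum_mul, Algebra.TensorProduct.tmul_mul_tmul, mul_one, map_sum,
    TensorProduct.map_tmul, mul'_apply, h3, h1, one_mul] at h2
  simp [← h2]

lemma antipode_eq_sum_of_left {Λ : A} {l : A →ₗ[k] k} (hΛ : IsLeftIntegral k Λ)
    (hl : IsLeftDualIntegral l) (h1 : l Λ = 1) :
    antipode k =
      ∑ i ∈ (ℛ k Λ).index, (l ∘ₗ mulRight k ((ℛ k Λ).right i)).smulRight ((ℛ k Λ).left i) := by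
  ext a
  rw [← sub_eq_zero, ← Module.forall_dual_apply_eq_zero_iff k]
  intro f
  have h2 := congr(mul' k k (map f l $(hΛ.one_tmul_mul_comul a)))
  have h3 : ∑ i ∈ (ℛ k Λ).index, f (antipode k a * (ℛ k Λ).left i) * l ((ℛ k Λ).right i) =
      f (antipode k a * 1) * l Λ :=
    ((ℛ k Λ).convMul_apply _ _).symm.trans
      congr($(hl (f ∘ₗ mulLeft k (antipode k a))) Λ)
  rw [← (ℛ k Λ).eq] at h2
  simp only [Finset.mul_sum, Algebra.TensorProduct.tmul_mul_tmul, mul_one, map_sum,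
    TensorProduct.map_tmul, mul'_apply, h3, h1, one_mul] at h2
  simp [← h2, mul_comm]

variable [FiniteDimensional k A]

/-- Radford's trace formula `Tr(S ∘ Q) = λ(∑ Λ₁ Q(Λ₂))` for right integrals. -/
lemma trace_antipode_comp_of_right {Λ : A} {l : A →ₗ[k] k} (hΛ : IsRightIntegral k Λ)
    (hl : IsRightDualIntegral l) (h1 : l Λ = 1) (Q : A →ₗ[k] A) :
    trace k A (antipode k ∘ₗ Q) = l ((toConv LinearMap.id * toConv Q).ofConv Λ) := by
  have h2 : (toConv LinearMap.id * toConv Q).ofConv Λ = _ :=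
    (ℛ k Λ).convMul_apply (toConv LinearMap.id) (toConv Q)
  have h3 (f : A →ₗ[k] k) (x : A) : f.smulRight x ∘ₗ Q = (f ∘ₗ Q).smulRight x := rfl
  -- Precomposition with `Q` is linear, so the trace is taken one rank-one term at a time.
  rw [h2, ← LinearMap.lcomp_apply' (S := k) (N := A), antipode_eq_sum_of_right hΛ hl h1, map_sum]
  simp [LinearMap.lcomp_apply', h3, trace_smulRight]

/-- Radford's trace formula `Tr(S ∘ P) = λ(∑ P(Λ₁) Λ₂)` for left integrals. -/
lemma trace_antipode_comp_of_left {Λ : A} {l : A →ₗ[k] k} (hΛ : IsLeftIntegral k Λ)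
    (hl : IsLeftDualIntegral l) (h1 : l Λ = 1) (P : A →ₗ[k] A) :
    trace k A (antipode k ∘ₗ P) = l ((toConv P * toConv LinearMap.id).ofConv Λ) := by
  have h2 : (toConv P * toConv LinearMap.id).ofConv Λ = _ :=
    (ℛ k Λ).convMul_apply (toConv P) (toConv LinearMap.id)
  have h3 (f : A →ₗ[k] k) (x : A) : f.smulRight x ∘ₗ P = (f ∘ₗ P).smulRight x := rfl
  rw [h2, ← LinearMap.lcomp_apply' (S := k) (N := A), antipode_eq_sum_of_left hΛ hl h1, map_sum]
  simp [LinearMap.lcomp_apply', h3, trace_smulRight]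

end Integrals

/-! ### Twisted powers -/

section Powers

variable {k A : Type*} [Field k] [Ring A] [HopfAlgebra k A]

lemma antipode_comp_variantPower (n : ℕ) (τ : A ≃ₐc[k] A) :
    antipode k ∘ₗ variantPower n τ =
      sweedlerProd ((List.range n).map fun i => powMap τ (i + 1)) ∘ₗ antipode k := by
  have h : ((List.range n).map fun i => powMap τ (n - i)).reverse =
      (List.range n).map fun i => powMap τ (i + 1) := by
    apply List.ext_getElem
    · simp
    · intro i h1 h2
      simp only [List.length_map, List.length_range] at h2
      simp only [List.getElem_reverse, List.getElem_map, List.getElem_range, List.length_map,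
        List.length_range]
      congr 1
      omega
  rw [← h]
  refine antipode_comp_sweedlerProd _ fun f hf => ?_
  obtain ⟨i, -, rfl⟩ := List.mem_map.mp hf
  exact antipode_comp_powMap τ _

lemma powMap_zero (τ : A ≃ₐc[k] A) : powMap τ 0 = LinearMap.id := rfl

lemma id_convMul_sweedlerProd_powMap_succ (n : ℕ) (τ : A ≃ₐc[k] A) :
    (toConv LinearMap.id * toConv (sweedlerProd ((List.range n).map fun i => powMap τ (i + 1)))
      ).ofConv = twistedHopfPower (n + 1) τ := by
  simp [twistedHopfPower, sweedlerProd, List.range_succ_eq_map, powMap_zero, Function.comp_def]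

lemma variantPower_convMul_id (n : ℕ) (τ : A ≃ₐc[k] A) :
    (toConv (variantPower n τ) * toConv LinearMap.id).ofConv =
      sweedlerProd ((List.range (n + 1)).map fun i => powMap τ (n - i)) := by
  simp [variantPower, sweedlerProd, List.range_succ, powMap_zero]

lemma symm_comp_powMap_symm {n i : ℕ} (hi : i ≤ n) (τ : A ≃ₐc[k] A)
    (hτ : orderOf (τ : A ≃ₐ[k] A) ∣ n + 1) :
    ((τ.symm : A ≃ₐ[k] A) : A →ₐ[k] A).toLinearMap ∘ₗ powMap τ.symm i = powMap τ (n - i) := by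
  -- The exponents add up to `n + 1`, a multiple of the order of `τ`.
  have h : (τ.symm : A ≃ₐ[k] A) ^ (i + 1) = (τ : A ≃ₐ[k] A) ^ (n - i) := by
    have h1 : (τ.symm : A ≃ₐ[k] A) = (τ : A ≃ₐ[k] A)⁻¹ := rfl
    rw [h1, inv_pow, inv_eq_iff_mul_eq_one, ← pow_add, show i + 1 + (n - i) = n + 1 by omega]
    exact orderOf_dvd_iff_pow_eq_one.mp hτ
  ext a
  simp [powMap, ← h, pow_succ']

lemma symm_comp_twistedHopfPower_symm (n : ℕ) (τ : A ≃ₐc[k] A)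
    (hτ : orderOf (τ : A ≃ₐ[k] A) ∣ n + 1) :
    ((τ.symm : A ≃ₐ[k] A) : A →ₐ[k] A).toLinearMap ∘ₗ twistedHopfPower (n + 1) τ.symm =
      sweedlerProd ((List.range (n + 1)).map fun i => powMap τ (n - i)) := by
  rw [twistedHopfPower, algHom_comp_sweedlerProd, List.map_map]
  congr 1
  refine List.map_congr_left fun i hi => symm_comp_powMap_symm ?_ τ hτ
  exact Nat.lt_succ_iff.mp (List.mem_range.mp hi)

end Powers

end TwistedIndicator

theorem mainTheorem7 {k : Type*} [Field k] [IsAlgClosed k] [CharZero k]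
    {A : Type*} [Ring A] [HopfAlgebra k A] [FiniteDimensional k A]
    (m : ℕ) (hm : 0 < m) (τ : A ≃ₐc[k] A) (hτ : orderOf (τ : A ≃ₐ[k] A) ∣ m) :
    (∀ (Λr : A) (lr : A →ₗ[k] k),
      TwistedIndicator.IsRightIntegral k Λr → TwistedIndicator.IsRightDualIntegral lr →
      lr Λr = 1 →
      TwistedIndicator.twistedIndicator m τ = lr (TwistedIndicator.twistedHopfPower m τ Λr)) ∧
    (∀ (Λl : A) (ll : A →ₗ[k] k),
      TwistedIndicator.IsLeftIntegral k Λl → TwistedIndicator.IsLeftDualIntegral ll →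
      ll Λl = 1 →
      TwistedIndicator.twistedIndicator m τ =
        ll (τ.symm (TwistedIndicator.twistedHopfPower m τ.symm Λl))) := by
  obtain ⟨n, rfl⟩ := Nat.exists_eq_succ_of_ne_zero hm.ne'
  refine ⟨fun Λr lr hΛ hl h1 => ?_, fun Λl ll hΛ hl h1 => ?_⟩
  · rw [← TwistedIndicator.id_convMul_sweedlerProd_powMap_succ,
      ← TwistedIndicator.trace_antipode_comp_of_right hΛ hl h1, LinearMap.trace_comp_comm',
      ← TwistedIndicator.antipode_comp_variantPower]
    rfl
  · have h2 := congr($(TwistedIndicator.symm_comp_twistedHopfPower_symm n τ hτ) Λl)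
    rw [← TwistedIndicator.variantPower_convMul_id] at h2
    exact (TwistedIndicator.trace_antipode_comp_of_left hΛ hl h1 _).trans congr(ll $h2.symm)
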